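/- For integers $\ell, n \ge 3$ let $ES_\ell(n)$ be the minimum $N$ such that every set of $N$ points in the Euclidean plane contains $\ell$ collinear points or $n$ points in convex position (that is, $n$ points forming the vertex set of a convex $n$-gon; no point lies in the convex hull of the others). Then, for all integers $\ell, n \ge 3$, with the exception of the pairs with $n = 4$ and $\ell \ge 5$, $$ES_\ell(n) \ \ge\ (3\ell-1)\cdot 2^{\,n-5} + 1 .$$ -/

import Mathlib

open scoped ENNReal

/-- The Euclidean plane. -/
abbrev Plane : Type := EuclideanSpace ℝ (Fin 2)

/-- `P` contains `ℓ` collinear members. -/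
def HasCollinear (ℓ : ℕ) (P : Finset Plane) : Prop :=
  ∃ S ⊆ P, S.card = ℓ ∧ Collinear ℝ (S : Set Plane)

/-- `S` is in convex position: no point of `S` lies in the convex hull of the other points of `S`,
i.e. (for at least three points) `S` is the vertex set of a convex polygon. -/
def InConvexPosition (S : Finset Plane) : Prop :=
  ConvexIndependent ℝ (fun p : S => (p : Plane))

/-- `P` contains `n` points in convex position. -/
def HasConvexPosition (n : ℕ) (P : Finset Plane) : Prop :=
  ∃ S ⊆ P, S.card = n ∧ InConvexPosition S

/-- Every `N`-element point set in the plane contains either `ℓ` collinear members or `n` points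
in convex position. -/
def Forces (ℓ n N : ℕ) : Prop :=
  ∀ P : Finset Plane, P.card = N → HasCollinear ℓ P ∨ HasConvexPosition n P

/-- The minimum `N` such that every `N`-element point set in the plane contains either `ℓ`
collinear members or `n` points in convex position (it would be `⊤` if there were no such `N`). -/
noncomputable def ES (ℓ n : ℕ) : ℕ∞ :=
  ⨅ (N : ℕ) (_ : Forces ℓ n N), (N : ℕ∞)

/-!
Call a set of points whose triples all turn clockwise, read from left to right, a cap, and one whose
triples all turn counterclockwise a cup. If a set `X` is moved far to the right of a set `Y` and
much further down, every line through two points of `Y` passes above `X` and every line through two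
points of `X` passes below `Y`. A cap or a cup meeting both parts then has at most one point in one
of them, so the sizes of sets whose caps have at most `a` and whose cups have at most `b` points add
up as in Pascal's triangle, and the total size over all pairs with `a + b = n` doubles from `n` to
`n + 1`. A set in convex position meeting both parts is a cap in `Y` together with a cup in `X`, so
all the sets with `a + b = n` can be joined in this way without creating `n` points in convex
position.

Write `ℓ = k + 1`. For `n = 6` the total is `6 * k + 4 = 2 * (3 * ℓ - 1)`, obtained from `k` points
on a line and from `2 * k` points on two lines. For `n = 3`, `n = 4` and `n = 5` single
configurations of points on a few segments suffice; since their triples have the same orientation as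
the endpoints of the segments, only finitely many sign conditions on integers have to be checked.
-/

open Filter SignType
open Finset.HasAntidiagonal (antidiagonal)

/-! ### Orientation -/

/-- Twice the signed area of the triangle `a b c`, positive if `a`, `b`, `c` are in
counterclockwise order. -/
noncomputable def orient (a b c : Plane) : ℝ :=
  (b 0 - a 0) * (c 1 - a 1) - (b 1 - a 1) * (c 0 - a 0)

theorem orient_rotate (a b c : Plane) : orient b c a = orient a b c := by
  simp only [orient]
  ring

@[simp] theorem orient_add_right (v a b c : Plane) :
    orient (a + v) (b + v) (c + v) = orient a b c := by
  simp [orient]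

theorem lineMap_coord (u v : Plane) (t : ℝ) (i : Fin 2) :
    AffineMap.lineMap u v t i = u i + t * (v i - u i) := by
  simp only [AffineMap.lineMap_apply, vsub_eq_sub, vadd_eq_add, PiLp.add_apply, PiLp.smul_apply,
    PiLp.sub_apply, smul_eq_mul]
  ring

theorem orient_eq_zero_of_collinear {s : Set Plane} (h : Collinear ℝ s) {a b c : Plane}
    (ha : a ∈ s) (hb : b ∈ s) (hc : c ∈ s) : orient a b c = 0 := by
  obtain ⟨v, hv⟩ := (collinear_iff_of_mem ha).1 h
  obtain ⟨r, rfl⟩ := hv b hb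
  obtain ⟨t, rfl⟩ := hv c hc
  simp only [orient, vadd_eq_add, PiLp.add_apply, PiLp.smul_apply, smul_eq_mul]
  ring

/-! ### Caps, cups and convex position -/

/-- The points of `P` have distinct first coordinates. -/
def DistinctX (P : Finset Plane) : Prop :=
  Set.InjOn (fun p : Plane => p 0) P

theorem DistinctX.mono {P Q : Finset Plane} (h : DistinctX Q) (hPQ : P ⊆ Q) : DistinctX P :=
  Set.InjOn.mono (Finset.coe_subset.2 hPQ) h

theorem DistinctX.map_add_right {P : Finset Plane} (h : DistinctX P) (v : Plane) :
    DistinctX (P.map (addRightEmbedding v)) := by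
  rw [DistinctX, Finset.coe_map]
  exact Set.InjOn.image_of_comp (g := fun p : Plane => p 0) fun a ha b hb hab =>
    h ha hb (by simpa using hab)

theorem DistinctX.exists_strictMono {S : Finset Plane} (hS : DistinctX S) {n : ℕ}
    (hn : n ≤ S.card) : ∃ p : Fin n → Plane, (∀ i, p i ∈ S) ∧ StrictMono fun i => p i 0 := by
  obtain ⟨S', hS', hcard⟩ := Finset.exists_subset_card_eq hn
  rw [← Finset.card_image_of_injOn (hS.mono hS')] at hcard
  choose p hp hpx using fun i => Finset.mem_image.1 (Finset.orderEmbOfFin_mem _ hcard i)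
  exact ⟨p, fun i => hS' (hp i), by
    simpa only [hpx] using (Finset.orderEmbOfFin _ hcard).strictMono⟩

/-- Every triple of points of `S`, read from left to right, has orientation `s`. Such a set is a
cap for `s = -1`, a cup for `s = 1` and collinear for `s = 0`. -/
def IsOriented (s : SignType) (S : Finset Plane) : Prop :=
  ∀ a ∈ S, ∀ b ∈ S, ∀ c ∈ S, a 0 < b 0 → b 0 < c 0 → sign (orient a b c) = s

theorem IsOriented.mono {s : SignType} {S T : Finset Plane} (h : IsOriented s T) (hST : S ⊆ T) :
    IsOriented s S :=
  fun a ha b hb c hc => h a (hST ha) b (hST hb) c (hST hc)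

/-- The caps (`s = -1`), cups (`s = 1`) or collinear subsets (`s = 0`) of `P` have at most `k`
points. -/
def OrientedLE (s : SignType) (k : ℕ) (P : Finset Plane) : Prop :=
  ∀ S ⊆ P, IsOriented s S → S.card ≤ k

namespace OrientedLE

variable {s : SignType} {k l : ℕ} {P Q : Finset Plane}

theorem mono (h : OrientedLE s k Q) (hPQ : P ⊆ Q) : OrientedLE s k P :=
  fun S hS => h S (hS.trans hPQ)

theorem of_card_le (h : P.card ≤ k) : OrientedLE s k P :=
  fun _ hS _ => (Finset.card_le_card hS).trans h

theorem eq_empty (h : OrientedLE s 0 P) : P = ∅ := by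
  refine Finset.eq_empty_of_forall_notMem fun p hp => ?_
  have : ({p} : Finset Plane).card ≤ 0 := h _ (Finset.singleton_subset_iff.2 hp) <| by
    simp [IsOriented]
  simp at this

theorem map_add_right (h : OrientedLE s k P) (v : Plane) :
    OrientedLE s k (P.map (addRightEmbedding v)) := by
  intro S hS hs
  obtain ⟨S, hS', rfl⟩ := Finset.subset_map_iff.1 hS
  rw [Finset.card_map]
  exact h S hS' (by simpa [IsOriented] using hs)

end OrientedLE

/-- The point `q` lies weakly below a chord of `S` that passes over it. -/
def BelowChord (S : Finset Plane) (q : Plane) : Prop :=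
  ∃ u ∈ S, ∃ v ∈ S, u 0 < q 0 ∧ q 0 < v 0 ∧ 0 ≤ orient u q v

/-- The point `q` lies weakly above a chord of `S` that passes under it. -/
def AboveChord (S : Finset Plane) (q : Plane) : Prop :=
  ∃ u ∈ S, ∃ v ∈ S, u 0 < q 0 ∧ q 0 < v 0 ∧ orient u q v ≤ 0

theorem exists_mem_segment_of_lt_of_lt {u v q : Plane} (hu : u 0 < q 0) (hv : q 0 < v 0) :
    ∃ a ∈ segment ℝ u v, a 0 = q 0 ∧ (a 1 - q 1) * (v 0 - u 0) = orient u q v := by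
  have huv : 0 < v 0 - u 0 := by linarith
  refine ⟨AffineMap.lineMap u v ((q 0 - u 0) / (v 0 - u 0)), ?_, ?_, ?_⟩
  · rw [segment_eq_image_lineMap]
    exact ⟨_, ⟨div_nonneg (by linarith) huv.le, (div_le_one huv).2 (by linarith)⟩, rfl⟩
  · rw [lineMap_coord, div_mul_cancel₀ _ huv.ne']
    ring
  · rw [lineMap_coord, orient]
    field_simp
    ring

theorem mem_segment_of_vertical {a b q : Plane} (ha : a 0 = q 0) (hb : b 0 = q 0)
    (hbq : b 1 ≤ q 1) (hqa : q 1 ≤ a 1) : q ∈ segment ℝ b a := by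
  obtain ⟨α, β, hα, hβ, hαβ, h⟩ : q 1 ∈ segment ℝ (b 1) (a 1) := by
    rw [segment_eq_Icc (hbq.trans hqa)]
    exact ⟨hbq, hqa⟩
  refine ⟨α, β, hα, hβ, hαβ, ?_⟩
  ext i
  fin_cases i
  · simp [ha, hb, ← add_mul, hαβ]
  · simpa using h

theorem segment_subset_convexHull_sdiff {S : Finset Plane} {u v q : Plane} (hu : u ∈ S)
    (hv : v ∈ S) (huq : u 0 < q 0) (hqv : q 0 < v 0) :
    segment ℝ u v ⊆ convexHull ℝ ((S : Set Plane) \ {q}) := by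
  refine segment_subset_convexHull ⟨hu, ?_⟩ ⟨hv, ?_⟩ <;> rintro rfl
  exacts [lt_irrefl _ huq, lt_irrefl _ hqv]

theorem InConvexPosition.not_aboveChord {S : Finset Plane} (h : InConvexPosition S) {q : Plane}
    (hq : q ∈ S) (hbelow : BelowChord S q) : ¬ AboveChord S q := by
  rintro ⟨u', hu', v', hv', huq', hqv', hle'⟩
  obtain ⟨u, hu, v, hv, huq, hqv, hle⟩ := hbelow
  obtain ⟨a, ha, ha0, ha1⟩ := exists_mem_segment_of_lt_of_lt huq hqv
  obtain ⟨b, hb, hb0, hb1⟩ := exists_mem_segment_of_lt_of_lt huq' hqv'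
  have hqa : q 1 ≤ a 1 :=
    sub_nonneg.1 (nonneg_of_mul_nonneg_left (ha1 ▸ hle) (by linarith))
  have hbq : b 1 ≤ q 1 :=
    sub_nonpos.1 (nonpos_of_mul_nonpos_left (hb1 ▸ hle') (by linarith))
  refine convexIndependent_set_iff_notMem_convexHull_sdiff.1 h q hq <|
    (convex_convexHull ℝ _).segment_subset ?_ ?_ (mem_segment_of_vertical ha0 hb0 hbq hqa)
  · exact segment_subset_convexHull_sdiff hu' hv' huq' hqv' hb
  · exact segment_subset_convexHull_sdiff hu hv huq hqv ha

theorem InConvexPosition.card_lt {S : Finset Plane} {a b : ℕ} (h : InConvexPosition S)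
    (hne : S.Nonempty) (hcap : OrientedLE (-1) a S) (hcup : OrientedLE 1 b S) :
    S.card < a + b := by
  classical
  set U := S.filter fun q => ¬ BelowChord S q
  set V := S.filter fun q => ¬ AboveChord S q
  have hU : U.card ≤ a := hcap U (Finset.filter_subset _ _) fun p hp q hq r hr hpq hqr => by
    rw [Finset.mem_filter] at hp hq hr
    by_contra hsign
    rw [sign_eq_neg_one_iff, not_lt] at hsign
    exact hq.2 ⟨p, hp.1, r, hr.1, hpq, hqr, hsign⟩
  have hV : V.card ≤ b := hcup V (Finset.filter_subset _ _) fun p hp q hq r hr hpq hqr => by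
    rw [Finset.mem_filter] at hp hq hr
    by_contra hsign
    rw [sign_eq_one_iff, not_lt] at hsign
    exact hq.2 ⟨p, hp.1, r, hr.1, hpq, hqr, hsign⟩
  have hunion : S ⊆ U ∪ V := fun q hq => by
    rw [Finset.mem_union, Finset.mem_filter, Finset.mem_filter, ← and_or_left]
    exact ⟨hq, not_and_or.1 fun hq' => h.not_aboveChord hq hq'.1 hq'.2⟩
  -- The leftmost point of `S` lies under and over no chord, so it is counted twice.
  have hinter : 0 < (U ∩ V).card := by
    obtain ⟨m, hm, hmin⟩ := S.exists_min_image (fun p => p 0) hne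
    refine Finset.card_pos.2 ⟨m, Finset.mem_inter.2
      ⟨Finset.mem_filter.2 ⟨hm, ?_⟩, Finset.mem_filter.2 ⟨hm, ?_⟩⟩⟩ <;>
    · rintro ⟨u, hu, -, -, hlt, -⟩
      exact (hmin u hu).not_gt hlt
  have := Finset.card_union_add_card_inter U V
  have := Finset.card_le_card hunion
  omega

theorem not_forces {k n : ℕ} {P : Finset Plane} (hcol : OrientedLE 0 k P)
    (hconv : ¬ HasConvexPosition n P) : ¬ Forces (k + 1) n P.card := by
  intro h
  obtain ⟨S, hS, hcard, hS0⟩ := (h P rfl).resolve_right hconv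
  have := hcol S hS fun a ha b hb c hc _ _ =>
    sign_eq_zero_iff.2 (orient_eq_zero_of_collinear hS0 ha hb hc)
  omega

theorem Forces.mono {ℓ n M N : ℕ} (h : Forces ℓ n M) (hMN : M ≤ N) : Forces ℓ n N := by
  rintro P rfl
  obtain ⟨Q, hQ, hcard⟩ := Finset.exists_subset_card_eq hMN
  exact (h Q hcard).imp (fun ⟨S, hS, hSℓ⟩ => ⟨S, hS.trans hQ, hSℓ⟩)
    fun ⟨S, hS, hSn⟩ => ⟨S, hS.trans hQ, hSn⟩

theorem add_one_le_ES_of_not_forces {ℓ n M : ℕ} (h : ¬ Forces ℓ n M) :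
    ((M + 1 : ℕ) : ℕ∞) ≤ ES ℓ n :=
  le_iInf₂ fun _ hN => Nat.cast_le.2 <| Nat.succ_le_of_lt <|
    lt_of_not_ge fun hNM => h (hN.mono hNM)

theorem ofReal_add_one_le_ES {ℓ n M : ℕ} {r : ℝ} (h : ¬ Forces ℓ n M) (hr : r ≤ M) :
    ENNReal.ofReal (r + 1) ≤ (ES ℓ n : ℝ≥0∞) :=
  calc ENNReal.ofReal (r + 1) ≤ ENNReal.ofReal ((M + 1 : ℕ) : ℝ) :=
        ENNReal.ofReal_le_ofReal (by push_cast; linarith)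
    _ = (((M + 1 : ℕ) : ℕ∞) : ℝ≥0∞) := by rw [ENNReal.ofReal_natCast, ENat.toENNReal_coe]
    _ ≤ (ES ℓ n : ℝ≥0∞) := ENat.toENNReal_mono (add_one_le_ES_of_not_forces h)

/-! ### Joining two sets -/

/-- The set `X` lies to the right of `Y` and below all lines spanned by `Y`, and `Y` lies above all
lines spanned by `X`. -/
structure RightBelow (Y X : Finset Plane) : Prop where
  lt : ∀ y ∈ Y, ∀ x ∈ X, y 0 < x 0
  neg : ∀ y ∈ Y, ∀ z ∈ Y, ∀ x ∈ X, y 0 < z 0 → orient y z x < 0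
  pos : ∀ y ∈ Y, ∀ x ∈ X, ∀ z ∈ X, x 0 < z 0 → 0 < orient y x z

theorem eventually_add_mul_pos (c : ℝ) {d : ℝ} (hd : 0 < d) : ∀ᶠ t in atTop, 0 < c + d * t :=
  (tendsto_atTop_add_const_left _ c (tendsto_id.const_mul_atTop hd)).eventually_gt_atTop 0

theorem eventually_orient_neg {y z : Plane} (h : y 0 < z 0) (x : Plane) (a : ℝ) :
    ∀ᶠ b in atTop, orient y z (x + !₂[a, -b]) < 0 := by
  filter_upwards [eventually_add_mul_pos (-orient y z (x + !₂[a, 0])) (sub_pos.2 h)] with b hb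
  have hshift : orient y z (x + !₂[a, -b]) = orient y z (x + !₂[a, 0]) - (z 0 - y 0) * b := by
    simp [orient]
    ring
  linarith

theorem eventually_orient_pos (y : Plane) {x z : Plane} (h : x 0 < z 0) (a : ℝ) :
    ∀ᶠ b in atTop, 0 < orient y (x + !₂[a, -b]) (z + !₂[a, -b]) := by
  filter_upwards [eventually_add_mul_pos (orient y (x + !₂[a, 0]) (z + !₂[a, 0])) (sub_pos.2 h)]
    with b hb
  have hshift : orient y (x + !₂[a, -b]) (z + !₂[a, -b]) =
      orient y (x + !₂[a, 0]) (z + !₂[a, 0]) + (z 0 - x 0) * b := by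
    simp [orient]
    ring
  linarith

theorem exists_rightBelow_map_add_right (Y X : Finset Plane) :
    ∃ v, RightBelow Y (X.map (addRightEmbedding v)) := by
  obtain ⟨a, ha⟩ : ∃ a : ℝ, ∀ y ∈ Y, ∀ x ∈ X, 0 < x 0 - y 0 + 1 * a :=
    Eventually.exists <| (Finset.eventually_all Y).2 fun y _ =>
      (Finset.eventually_all X).2 fun x _ => eventually_add_mul_pos (x 0 - y 0) one_pos
  have hneg : ∀ᶠ b in atTop, ∀ y ∈ Y, ∀ z ∈ Y, ∀ x ∈ X, y 0 < z 0 →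
      orient y z (x + !₂[a, -b]) < 0 := by
    simp only [Finset.eventually_all, eventually_imp_distrib_left]
    exact fun y _ z _ x _ h => eventually_orient_neg h x a
  have hpos : ∀ᶠ b in atTop, ∀ y ∈ Y, ∀ x ∈ X, ∀ z ∈ X, x 0 < z 0 →
      0 < orient y (x + !₂[a, -b]) (z + !₂[a, -b]) := by
    simp only [Finset.eventually_all, eventually_imp_distrib_left]
    exact fun y _ x _ z _ h => eventually_orient_pos y h a
  obtain ⟨b, hb_neg, hb_pos⟩ := (hneg.and hpos).exists
  refine ⟨!₂[a, -b], ?_, ?_, ?_⟩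
  · simpa [sub_add_eq_add_sub] using ha
  · simpa using hb_neg
  · simpa using hb_pos

theorem subset_or_subset_or_meets_both {α : Type*} [DecidableEq α] {S Y X : Finset α}
    (hS : S ⊆ Y ∪ X) :
    S ⊆ Y ∨ S ⊆ X ∨
      (S ∩ Y).Nonempty ∧ (S ∩ X).Nonempty ∧ S.card ≤ (S ∩ Y).card + (S ∩ X).card := by
  have hcard : S.card ≤ (S ∩ Y).card + (S ∩ X).card := by
    simpa only [← Finset.inter_union_distrib_left, Finset.inter_eq_left.2 hS] using
      Finset.card_union_le (S ∩ Y) (S ∩ X)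
  rcases (S ∩ Y).eq_empty_or_nonempty with hY | hY
  · exact .inr (.inl ((Finset.disjoint_iff_inter_eq_empty.2 hY).left_le_of_le_sup_left hS))
  rcases (S ∩ X).eq_empty_or_nonempty with hX | hX
  · exact .inl ((Finset.disjoint_iff_inter_eq_empty.2 hX).left_le_of_le_sup_right hS)
  exact .inr (.inr ⟨hY, hX, hcard⟩)

theorem DistinctX.card_le_one {S : Finset Plane} (hS : DistinctX S)
    (h : ∀ a ∈ S, ∀ b ∈ S, ¬ a 0 < b 0) : S.card ≤ 1 :=
  Finset.card_le_one.2 fun a ha b hb =>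
    hS ha hb (le_antisymm (not_lt.1 (h b hb a ha)) (not_lt.1 (h a ha b hb)))

namespace RightBelow

variable {Y X : Finset Plane} {s : SignType} {k a b n : ℕ}

theorem distinctX_union (h : RightBelow Y X) (hY : DistinctX Y) (hX : DistinctX X) :
    DistinctX (Y ∪ X) := by
  unfold DistinctX
  rw [Finset.coe_union, Set.injOn_union]
  · exact ⟨hY, hX, fun y hy x hx => (h.lt y hy x hx).ne⟩
  · exact Set.disjoint_left.2 fun p hpY hpX => lt_irrefl _ (h.lt p hpY p hpX)

theorem card_union (h : RightBelow Y X) : (Y ∪ X).card = Y.card + X.card :=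
  Finset.card_union_of_disjoint
    (Finset.disjoint_left.2 fun p hpY hpX => lt_irrefl _ (h.lt p hpY p hpX))

theorem card_inter_left_le_one (h : RightBelow Y X) (hY : DistinctX Y) (hs : s ≠ -1)
    {S : Finset Plane} (hS : IsOriented s S) (hne : (S ∩ X).Nonempty) : (S ∩ Y).card ≤ 1 := by
  obtain ⟨x, hx⟩ := hne
  rw [Finset.mem_inter] at hx
  refine (hY.mono Finset.inter_subset_right).card_le_one fun y hy z hz hyz => hs ?_
  rw [Finset.mem_inter] at hy hz
  rw [← hS y hy.1 z hz.1 x hx.1 hyz (h.lt z hz.2 x hx.2)]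
  exact sign_neg (h.neg y hy.2 z hz.2 x hx.2 hyz)

theorem card_inter_right_le_one (h : RightBelow Y X) (hX : DistinctX X) (hs : s ≠ 1)
    {S : Finset Plane} (hS : IsOriented s S) (hne : (S ∩ Y).Nonempty) : (S ∩ X).card ≤ 1 := by
  obtain ⟨y, hy⟩ := hne
  rw [Finset.mem_inter] at hy
  refine (hX.mono Finset.inter_subset_right).card_le_one fun x hx z hz hxz => hs ?_
  rw [Finset.mem_inter] at hx hz
  rw [← hS y hy.1 x hx.1 z hz.1 (h.lt y hy.2 x hx.2) hxz]
  exact sign_pos (h.pos y hy.2 x hx.2 z hz.2 hxz)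

theorem cap_union (h : RightBelow Y X) (hXx : DistinctX X) (hY : OrientedLE (-1) a Y)
    (hX : OrientedLE (-1) (a + 1) X) : OrientedLE (-1) (a + 1) (Y ∪ X) := by
  intro S hS hs
  rcases subset_or_subset_or_meets_both hS with hSY | hSX | ⟨hne, -, hcard⟩
  · exact (hY S hSY hs).trans a.le_succ
  · exact hX S hSX hs
  · have := hY _ Finset.inter_subset_right (hs.mono Finset.inter_subset_left)
    have := h.card_inter_right_le_one hXx (by decide) hs hne
    omega

theorem cup_union (h : RightBelow Y X) (hYx : DistinctX Y) (hY : OrientedLE 1 (b + 1) Y)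
    (hX : OrientedLE 1 b X) : OrientedLE 1 (b + 1) (Y ∪ X) := by
  intro S hS hs
  rcases subset_or_subset_or_meets_both hS with hSY | hSX | ⟨-, hne, hcard⟩
  · exact hY S hSY hs
  · exact (hX S hSX hs).trans b.le_succ
  · have := hX _ Finset.inter_subset_right (hs.mono Finset.inter_subset_left)
    have := h.card_inter_left_le_one hYx (by decide) hs hne
    omega

theorem collinear_union (h : RightBelow Y X) (hk : 2 ≤ k) (hYx : DistinctX Y) (hXx : DistinctX X)
    (hY : OrientedLE 0 k Y) (hX : OrientedLE 0 k X) : OrientedLE 0 k (Y ∪ X) := by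
  intro S hS hs
  rcases subset_or_subset_or_meets_both hS with hSY | hSX | ⟨hneY, hneX, hcard⟩
  · exact hY S hSY hs
  · exact hX S hSX hs
  · have := h.card_inter_left_le_one hYx (by decide) hs hneX
    have := h.card_inter_right_le_one hXx (by decide) hs hneY
    omega

/-
A set in convex position that meets both parts is a cap in `Y` and a cup in `X`: a point of `Y`
below a chord of `Y` would also lie above the chord to a point of `X`.
-/
theorem not_hasConvexPosition_union (h : RightBelow Y X) (hY : ¬ HasConvexPosition n Y)
    (hX : ¬ HasConvexPosition n X) (hcap : OrientedLE (-1) a Y) (hcup : OrientedLE 1 b X)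
    (hn : a + b < n) : ¬ HasConvexPosition n (Y ∪ X) := by
  rintro ⟨S, hS, hcard, hconv⟩
  rcases subset_or_subset_or_meets_both hS with hSY | hSX | ⟨⟨y, hy⟩, ⟨x, hx⟩, hle⟩
  · exact hY ⟨S, hSY, hcard, hconv⟩
  · exact hX ⟨S, hSX, hcard, hconv⟩
  rw [Finset.mem_inter] at hy hx
  have hcapS : (S ∩ Y).card ≤ a :=
    hcap _ Finset.inter_subset_right fun p hp q hq r hr hpq hqr => by
      rw [Finset.mem_inter] at hp hq hr
      by_contra hsign
      rw [sign_eq_neg_one_iff, not_lt] at hsign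
      exact hconv.not_aboveChord hq.1 ⟨p, hp.1, r, hr.1, hpq, hqr, hsign⟩
        ⟨p, hp.1, x, hx.1, hpq, h.lt q hq.2 x hx.2, (h.neg p hp.2 q hq.2 x hx.2 hpq).le⟩
  have hcupS : (S ∩ X).card ≤ b :=
    hcup _ Finset.inter_subset_right fun p hp q hq r hr hpq hqr => by
      rw [Finset.mem_inter] at hp hq hr
      by_contra hsign
      rw [sign_eq_one_iff, not_lt] at hsign
      exact hconv.not_aboveChord hq.1
        ⟨y, hy.1, r, hr.1, h.lt y hy.2 q hq.2, hqr, (h.pos y hy.2 q hq.2 r hr.2 hqr).le⟩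
        ⟨p, hp.1, r, hr.1, hpq, hqr, hsign⟩
  omega

end RightBelow

/-- A set with distinct first coordinates, at most `k` points on a line, caps of at most `a`
points and cups of at most `b` points. -/
structure CupCapFree (k a b : ℕ) (P : Finset Plane) : Prop where
  distinctX : DistinctX P
  collinear : OrientedLE 0 k P
  cap : OrientedLE (-1) a P
  cup : OrientedLE 1 b P

theorem CupCapFree.map_add_right {k a b : ℕ} {P : Finset Plane} (h : CupCapFree k a b P)
    (v : Plane) : CupCapFree k a b (P.map (addRightEmbedding v)) :=
  ⟨h.distinctX.map_add_right v, h.collinear.map_add_right v, h.cap.map_add_right v,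
    h.cup.map_add_right v⟩

theorem CupCapFree.not_hasConvexPosition {k a b : ℕ} {P : Finset Plane} (h : CupCapFree k a b P)
    (hab : 0 < a + b) : ¬ HasConvexPosition (a + b) P := by
  rintro ⟨S, hS, hcard, hconv⟩
  exact (hconv.card_lt (Finset.card_pos.1 (hcard ▸ hab)) (h.cap.mono hS) (h.cup.mono hS)).ne hcard

/-- Some `N`-point set is `CupCapFree k a b`. -/
def CupCapSize (k a b N : ℕ) : Prop :=
  ∃ P : Finset Plane, P.card = N ∧ CupCapFree k a b P

namespace CupCapSize

variable {k a b M N : ℕ}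

theorem of_le (hk : N ≤ k) (ha : N ≤ a) (hb : N ≤ b) (hN : N ≤ 1) : CupCapSize k a b N := by
  obtain ⟨P, -, hP⟩ :=
    Finset.exists_subset_card_eq (s := {(0 : Plane)}) (n := N) (by simpa using hN)
  refine ⟨P, hP, fun p hp q hq _ => Finset.card_le_one.1 (hP.trans_le hN) p hp q hq,
    .of_card_le ?_, .of_card_le ?_, .of_card_le ?_⟩ <;> omega

theorem zero : CupCapSize k a b 0 :=
  .of_le k.zero_le a.zero_le b.zero_le zero_le_one

theorem one (hk : 0 < k) (ha : 0 < a) (hb : 0 < b) : CupCapSize k a b 1 :=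
  .of_le hk ha hb le_rfl

theorem eq_zero_of_cap (h : CupCapSize k 0 b N) : N = 0 := by
  obtain ⟨P, rfl, hP⟩ := h
  exact Finset.card_eq_zero.2 hP.cap.eq_empty

theorem eq_zero_of_cup (h : CupCapSize k a 0 N) : N = 0 := by
  obtain ⟨P, rfl, hP⟩ := h
  exact Finset.card_eq_zero.2 hP.cup.eq_empty

theorem exists_rightBelow (h : CupCapSize k a b N) (Y : Finset Plane) :
    ∃ X, X.card = N ∧ CupCapFree k a b X ∧ RightBelow Y X := by
  obtain ⟨P, rfl, hP⟩ := h
  obtain ⟨v, hv⟩ := exists_rightBelow_map_add_right Y P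
  exact ⟨_, Finset.card_map _, hP.map_add_right v, hv⟩

theorem add (hk : 2 ≤ k) (hM : CupCapSize k a (b + 1) M) (hN : CupCapSize k (a + 1) b N) :
    CupCapSize k (a + 1) (b + 1) (M + N) := by
  obtain ⟨Y, rfl, hY⟩ := hM
  obtain ⟨X, rfl, hX, h⟩ := hN.exists_rightBelow Y
  exact ⟨Y ∪ X, h.card_union, h.distinctX_union hY.distinctX hX.distinctX,
    h.collinear_union hk hY.distinctX hX.distinctX hY.collinear hX.collinear,
    h.cap_union hX.distinctX hY.cap hX.cap, h.cup_union hY.distinctX hY.cup hX.cup⟩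

end CupCapSize

/-- There are `CupCapFree k a b` sets, one for each pair with `a + b = n`, with `M` points in
total. -/
def CupCapRow (k n M : ℕ) : Prop :=
  ∃ N : ℕ → ℕ → ℕ, (∀ a b, a + b = n → CupCapSize k a b (N a b)) ∧
    ∑ p ∈ antidiagonal n, N p.1 p.2 = M

theorem CupCapRow.succ {k n M : ℕ} (hk : 2 ≤ k) (h : CupCapRow k (n + 1) M) :
    CupCapRow k (n + 2) (2 * M) := by
  obtain ⟨N, hN, rfl⟩ := h
  have hcap : N 0 (n + 1) = 0 := (hN 0 (n + 1) (by omega)).eq_zero_of_cap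
  have hcup : N (n + 1) 0 = 0 := (hN (n + 1) 0 (by omega)).eq_zero_of_cup
  refine ⟨fun | a + 1, b + 1 => N a (b + 1) + N (a + 1) b | _, _ => 0, ?_, ?_⟩
  · rintro (_ | a) (_ | b) hab
    · omega
    · exact .zero
    · exact .zero
    · exact .add hk (hN a (b + 1) (by omega)) (hN (a + 1) b (by omega))
  · rw [Finset.Nat.sum_antidiagonal_succ, Finset.Nat.sum_antidiagonal_succ']
    simp only [Finset.sum_add_distrib, zero_add]
    rw [two_mul]
    nth_rewrite 1 [Finset.Nat.sum_antidiagonal_succ']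
    rw [Finset.Nat.sum_antidiagonal_succ]
    simp only [hcap, hcup, zero_add]

theorem CupCapRow.iterate {k n M : ℕ} (hk : 2 ≤ k) (h : CupCapRow k (n + 1) M) (t : ℕ) :
    CupCapRow k (n + 1 + t) (M * 2 ^ t) := by
  induction t with
  | zero => simpa using h
  | succ t ih =>
    rw [pow_succ, mul_comm (2 ^ t), mul_left_comm]
    rw [Nat.add_right_comm] at ih
    convert ih.succ hk using 1
    omega

theorem exists_not_hasConvexPosition {k n : ℕ} (hk : 2 ≤ k) (hn : 0 < n)
    {N : ℕ → ℕ → ℕ} (hN : ∀ a b, a + b = n → CupCapSize k a b (N a b)) (a : ℕ) (ha : a ≤ n) :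
    ∃ P : Finset Plane, P.card = ∑ i ∈ Finset.range (a + 1), N i (n - i) ∧ DistinctX P ∧
      OrientedLE 0 k P ∧ OrientedLE (-1) a P ∧ ¬ HasConvexPosition n P := by
  induction a with
  | zero =>
    obtain ⟨P, hcard, hP⟩ := hN 0 n (zero_add n)
    exact ⟨P, by simpa using hcard, hP.distinctX, hP.collinear, hP.cap,
      by simpa using hP.not_hasConvexPosition (by omega)⟩
  | succ a ih =>
    obtain ⟨Y, hcardY, hYx, hYcol, hYcap, hYconv⟩ := ih (by omega)
    obtain ⟨b, rfl⟩ := Nat.exists_eq_add_of_le ha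
    obtain ⟨X, hcardX, hX, h⟩ := (hN (a + 1) b rfl).exists_rightBelow Y
    refine ⟨Y ∪ X, ?_, h.distinctX_union hYx hX.distinctX,
      h.collinear_union hk hYx hX.distinctX hYcol hX.collinear,
      h.cap_union hX.distinctX hYcap hX.cap,
      h.not_hasConvexPosition_union hYconv (hX.not_hasConvexPosition hn) hYcap hX.cup (by omega)⟩
    rw [h.card_union, Finset.sum_range_succ, hcardY, hcardX, Nat.add_sub_cancel_left]

theorem CupCapRow.not_forces {k n M : ℕ} (hk : 2 ≤ k) (hn : 0 < n) (h : CupCapRow k n M) :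
    ¬ Forces (k + 1) n M := by
  obtain ⟨N, hN, rfl⟩ := h
  obtain ⟨P, hcard, -, hcol, -, hconv⟩ := exists_not_hasConvexPosition hk hn hN n le_rfl
  rw [Finset.Nat.sum_antidiagonal_eq_sum_range_succ N, ← hcard]
  exact _root_.not_forces hcol hconv

/-! ### Points on segments -/

theorem convex_setOf_sign_eq (s : SignType) : Convex ℝ {x : ℝ | sign x = s} := by
  cases s
  · simp only [zero_eq_zero, sign_eq_zero_iff]
    exact convex_singleton 0
  · simp only [neg_eq_neg_one, sign_eq_neg_one_iff]
    exact convex_Iio 0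
  · simp only [pos_eq_one, sign_eq_one_iff]
    exact convex_Ioi 0

theorem convex_setOf_sign_orient_eq (b c : Plane) (s : SignType) :
    Convex ℝ {a | sign (orient a b c) = s} := by
  intro a ha a' ha' α β hα hβ hαβ
  have haffine : orient (α • a + β • a') b c = α • orient a b c + β • orient a' b c := by
    simp only [orient, PiLp.add_apply, PiLp.smul_apply, smul_eq_mul]
    linear_combination (c 0 * b 1 - b 0 * c 1) * hαβ
  change sign _ = s
  rw [haffine]
  exact convex_setOf_sign_eq s ha ha' hα hβ hαβ

theorem sign_orient_of_mem_segment {u v p q : Plane} (huv : u 0 ≤ v 0) (hp : p ∈ segment ℝ u v)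
    (hq : q ∈ segment ℝ u v) (hpq : p 0 < q 0) (r : Plane) :
    sign (orient p q r) = sign (orient u v r) := by
  rw [segment_eq_image_lineMap] at hp hq
  obtain ⟨t, -, rfl⟩ := hp
  obtain ⟨t', -, rfl⟩ := hq
  have htt' : 0 < t' - t := by
    rw [lineMap_coord, lineMap_coord] at hpq
    exact sub_pos.2 (lt_of_mul_lt_mul_right (by linarith) (sub_nonneg.2 huv))
  have hscale : orient (AffineMap.lineMap u v t) (AffineMap.lineMap u v t') r =
      (t' - t) * orient u v r := by
    simp only [orient, lineMap_coord]
    ring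
  rw [hscale, sign_mul, sign_pos htt', one_mul]

theorem coord_mem_Icc_of_mem_segment {u v p : Plane} (huv : u 0 ≤ v 0) (hp : p ∈ segment ℝ u v) :
    p 0 ∈ Set.Icc (u 0) (v 0) := by
  rw [segment_eq_image_lineMap] at hp
  obtain ⟨t, ⟨ht0, ht1⟩, rfl⟩ := hp
  rw [lineMap_coord]
  constructor <;> nlinarith

/-- The point of the plane with the given integer coordinates. -/
noncomputable def gridPoint (p : ℤ × ℤ) : Plane :=
  !₂[(p.1 : ℝ), (p.2 : ℝ)]

/-- The integer version of `orient`, on which sign conditions can be decided by evaluation. -/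
def gridOrient (a b c : ℤ × ℤ) : ℤ :=
  (b.1 - a.1) * (c.2 - a.2) - (b.2 - a.2) * (c.1 - a.1)

theorem sign_orient_gridPoint (p q r : ℤ × ℤ) :
    sign (orient (gridPoint p) (gridPoint q) (gridPoint r)) = sign (gridOrient p q r) := by
  have hcast : orient (gridPoint p) (gridPoint q) (gridPoint r) = (gridOrient p q r : ℝ) := by
    simp [orient, gridOrient, gridPoint]
  simp only [sign_apply, hcast, Int.cast_pos, Int.cast_lt_zero]

/-- A family of `m` segments with integer endpoints, possibly degenerate to points. Placing `k`
points on each segment gives the explicit configurations used for small `n`. -/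
structure SegmentSystem (m : ℕ) where
  left : Fin m → ℤ × ℤ
  right : Fin m → ℤ × ℤ

namespace SegmentSystem

variable {m k : ℕ} (F : SegmentSystem m)

/-- The endpoints of a segment. -/
def ends (c : Fin m) : Finset (ℤ × ℤ) :=
  {F.left c, F.right c}

/-- The common orientation of the triples from left to right on the segments `a`, `b`, `c` of a
coherent system. When `a = b`, the two endpoints of `a` represent the first two points. -/
noncomputable def orientation (a b c : Fin m) : SignType :=
  sign (gridOrient (F.left a) (if a = b then F.right b else F.left b) (F.right c))

/-- The segments are listed from left to right, none is vertical, and the orientation of a triple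
of their endpoints only depends on the segments that the three endpoints belong to. -/
structure IsCoherent : Prop where
  eq_or_lt : ∀ c, F.left c = F.right c ∨ (F.left c).1 < (F.right c).1
  right_lt_left : ∀ a b, a < b → (F.right a).1 < (F.left b).1
  sign_gridOrient : ∀ a b c, ∀ p ∈ F.ends a, ∀ q ∈ F.ends b, ∀ r ∈ F.ends c,
    p.1 < q.1 → q.1 < r.1 → sign (gridOrient p q r) = F.orientation a b c

/-- The real segment with index `c`. -/
def toSegment (c : Fin m) : Set Plane :=
  segment ℝ (gridPoint (F.left c)) (gridPoint (F.right c))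

/-- The `k` points of the segment `c` that start at its left end and divide it into `k` equal
parts; they are all equal if the segment is a point. -/
noncomputable def points (k : ℕ) (c : Fin m) : Finset Plane :=
  (Finset.range k).image fun i : ℕ =>
    AffineMap.lineMap (gridPoint (F.left c)) (gridPoint (F.right c)) ((i : ℝ) / k)

/-- The point configuration with `k` points on each nondegenerate segment and one point on each
degenerate one. -/
noncomputable def cloud (k : ℕ) : Finset Plane :=
  Finset.univ.biUnion (F.points k)

/-- A point on the segment `a` may be followed, further to the right, by one on `b`. -/
abbrev Step (a b : Fin m) : Prop :=
  a ≤ b ∧ (a = b → F.left a ≠ F.right a)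

/-- The points of a sequence from left to right may lie on the segments listed in `w`. -/
abbrev IsWord {n : ℕ} (w : Fin n → Fin m) : Prop :=
  ∀ i j, i < j → F.Step (w i) (w j)

/-- Points on the segments listed in `w` contain one that lies both below and above a chord. -/
abbrev IsSandwiched {n : ℕ} (w : Fin n → Fin m) : Prop :=
  ∃ q, (∃ u < q, ∃ v > q, 0 ≤ F.orientation (w u) (w q) (w v)) ∧
    ∃ u < q, ∃ v > q, F.orientation (w u) (w q) (w v) ≤ 0

theorem left_mem_ends (c : Fin m) : F.left c ∈ F.ends c :=
  Finset.mem_insert_self _ _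

theorem right_mem_ends (c : Fin m) : F.right c ∈ F.ends c :=
  Finset.mem_insert_of_mem (Finset.mem_singleton_self _)

variable {F}

theorem mem_cloud {p : Plane} : p ∈ F.cloud k ↔ ∃ c, p ∈ F.points k c := by
  simp [cloud]

theorem mem_toSegment_of_mem_points {c : Fin m} {p : Plane} (hp : p ∈ F.points k c) :
    p ∈ F.toSegment c := by
  obtain ⟨i, hi, rfl⟩ := Finset.mem_image.1 hp
  have hik : (i : ℝ) ≤ k := Nat.cast_le.2 (Finset.mem_range.1 hi).le
  rw [toSegment, segment_eq_image_lineMap]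
  exact ⟨_, ⟨by positivity, div_le_one_of_le₀ hik k.cast_nonneg⟩, rfl⟩

theorem sign_orient_of_ends {c : Fin m} {p q r : Plane} {s : SignType}
    (h : ∀ e ∈ F.ends c, sign (orient (gridPoint e) p q) = s) (hr : r ∈ F.toSegment c) :
    sign (orient r p q) = s :=
  (convex_setOf_sign_orient_eq p q s).segment_subset (h _ (F.left_mem_ends c))
    (h _ (F.right_mem_ends c)) hr

theorem eq_of_mem_points {c : Fin m} {p q : Plane} (hc : F.left c = F.right c)
    (hp : p ∈ F.points k c) (hq : q ∈ F.points k c) : p = q := by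
  replace hp := mem_toSegment_of_mem_points hp
  replace hq := mem_toSegment_of_mem_points hq
  rw [toSegment, hc, segment_same, Set.mem_singleton_iff] at hp hq
  rw [hp, hq]

namespace IsCoherent

theorem left_le_right (hF : F.IsCoherent) (c : Fin m) :
    gridPoint (F.left c) 0 ≤ gridPoint (F.right c) 0 :=
  Int.cast_le.2 <| (hF.eq_or_lt c).elim (fun h => h ▸ le_rfl) le_of_lt

theorem lt_of_lt (hF : F.IsCoherent) {a b : Fin m} (hab : a < b) {p q : Plane}
    (hp : p ∈ F.points k a) (hq : q ∈ F.points k b) : p 0 < q 0 :=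
  calc p 0 ≤ gridPoint (F.right a) 0 :=
        (coord_mem_Icc_of_mem_segment (hF.left_le_right a) (mem_toSegment_of_mem_points hp)).2
    _ < gridPoint (F.left b) 0 := Int.cast_lt.2 (hF.right_lt_left a b hab)
    _ ≤ q 0 :=
        (coord_mem_Icc_of_mem_segment (hF.left_le_right b) (mem_toSegment_of_mem_points hq)).1

theorem step_of_lt (hF : F.IsCoherent) {a b : Fin m} {p q : Plane} (hp : p ∈ F.points k a)
    (hq : q ∈ F.points k b) (hpq : p 0 < q 0) : F.Step a b := by
  refine ⟨not_lt.1 fun hba => (hF.lt_of_lt hba hq hp).not_gt hpq, ?_⟩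
  rintro rfl hc
  exact hpq.ne (congrArg (· 0) (eq_of_mem_points hc hp hq))

theorem lineMap_injOn (hF : F.IsCoherent) {c : Fin m} (hc : F.left c ≠ F.right c) :
    Set.InjOn (fun i : ℕ => AffineMap.lineMap (gridPoint (F.left c)) (gridPoint (F.right c))
      ((i : ℝ) / k) 0) (Finset.range k) := by
  intro i hi j _ hij
  have hk : (k : ℝ) ≠ 0 := Nat.cast_ne_zero.2 (Finset.mem_range.1 hi).ne_bot
  have hlt : gridPoint (F.left c) 0 < gridPoint (F.right c) 0 :=
    Int.cast_lt.2 ((hF.eq_or_lt c).resolve_left hc)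
  simp only [lineMap_coord, add_right_inj] at hij
  exact Nat.cast_injective ((div_left_inj' hk).1 (mul_right_cancel₀ (sub_pos.2 hlt).ne' hij))

theorem distinctX_cloud (hF : F.IsCoherent) (k : ℕ) : DistinctX (F.cloud k) := by
  intro p hp q hq hpq
  obtain ⟨a, ha⟩ := mem_cloud.1 hp
  obtain ⟨b, hb⟩ := mem_cloud.1 hq
  obtain hab | rfl | hab := lt_trichotomy a b
  · exact absurd hpq (hF.lt_of_lt hab ha hb).ne
  · by_cases hc : F.left a = F.right a
    · exact eq_of_mem_points hc ha hb
    obtain ⟨i, hi, rfl⟩ := Finset.mem_image.1 ha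
    obtain ⟨j, hj, rfl⟩ := Finset.mem_image.1 hb
    rw [hF.lineMap_injOn hc hi hj (by simpa only using hpq)]
  · exact absurd hpq (hF.lt_of_lt hab hb ha).ne'

theorem card_points (hF : F.IsCoherent) (hk : 0 < k) (c : Fin m) :
    (F.points k c).card = if F.left c = F.right c then 1 else k := by
  split_ifs with hc
  · refine le_antisymm
      (Finset.card_le_one.2 fun p hp q hq => eq_of_mem_points hc hp hq) (Finset.card_pos.2 ?_)
    exact (Finset.nonempty_range_iff.2 hk.ne').image _
  · have hinj := (hF.lineMap_injOn (k := k) hc).of_comp (g := fun p : Plane => p 0)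
    rw [points, Finset.card_image_of_injOn hinj, Finset.card_range]

theorem card_cloud (hF : F.IsCoherent) (hk : 0 < k) :
    (F.cloud k).card = ∑ c, if F.left c = F.right c then 1 else k := by
  rw [cloud, Finset.card_biUnion]
  · exact Finset.sum_congr rfl fun c _ => hF.card_points hk c
  · intro a _ b _ hab
    refine Finset.disjoint_left.2 fun p hpa hpb => ?_
    rcases hab.lt_or_gt with h | h
    exacts [(hF.lt_of_lt h hpa hpb).false, (hF.lt_of_lt h hpb hpa).false]

theorem ends_lt_ends (hF : F.IsCoherent) {a b : Fin m} (hab : a < b) :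
    ∀ p ∈ F.ends a, ∀ q ∈ F.ends b, p.1 < q.1 := by
  have hle (c) : (F.left c).1 ≤ (F.right c).1 := Int.cast_le.1 (hF.left_le_right c)
  have := hle a
  have := hle b
  have := hF.right_lt_left a b hab
  simp only [ends, Finset.mem_insert, Finset.mem_singleton]
  rintro p (rfl | rfl) q (rfl | rfl) <;> omega

theorem sign_orient_of_lt_of_lt (hF : F.IsCoherent) {a b c : Fin m} (hab : a < b) (hbc : b < c)
    {p q r : Plane} (hp : p ∈ F.toSegment a) (hq : q ∈ F.toSegment b) (hr : r ∈ F.toSegment c) :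
    sign (orient p q r) = F.orientation a b c := by
  refine sign_orient_of_ends (fun p hp => ?_) hp
  rw [← orient_rotate]
  refine sign_orient_of_ends (fun q hq => ?_) hq
  rw [← orient_rotate]
  refine sign_orient_of_ends (fun r hr => ?_) hr
  rw [← orient_rotate, sign_orient_gridPoint]
  exact hF.sign_gridOrient a b c p hp q hq r hr (hF.ends_lt_ends hab p hp q hq)
    (hF.ends_lt_ends hbc q hq r hr)

theorem sign_orient (hF : F.IsCoherent) {a b c : Fin m} {p q r : Plane} (hp : p ∈ F.points k a)
    (hq : q ∈ F.points k b) (hr : r ∈ F.points k c) (hpq : p 0 < q 0) (hqr : q 0 < r 0) :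
    sign (orient p q r) = F.orientation a b c := by
  obtain ⟨hab, hne⟩ := hF.step_of_lt hp hq hpq
  obtain ⟨hbc, hne'⟩ := hF.step_of_lt hq hr hqr
  replace hp := mem_toSegment_of_mem_points hp
  replace hq := mem_toSegment_of_mem_points hq
  replace hr := mem_toSegment_of_mem_points hr
  rcases hab.eq_or_lt with rfl | hab
  · rw [sign_orient_of_mem_segment (hF.left_le_right a) hp hq hpq, orient_rotate]
    refine sign_orient_of_ends (fun r hr => ?_) hr
    rw [← orient_rotate, sign_orient_gridPoint]
    rcases hbc.eq_or_lt with rfl | hac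
    · rw [ends, Finset.mem_insert, Finset.mem_singleton] at hr
      rcases hr with rfl | rfl <;> simp [orientation, gridOrient, mul_comm]
    · exact hF.sign_gridOrient a a c _ (F.left_mem_ends a) _ (F.right_mem_ends a) r hr
        ((hF.eq_or_lt a).resolve_left (hne rfl))
        (hF.ends_lt_ends hac _ (F.right_mem_ends a) r hr)
  rcases hbc.eq_or_lt with rfl | hbc
  · rw [← orient_rotate, sign_orient_of_mem_segment (hF.left_le_right b) hq hr hqr, orient_rotate]
    refine sign_orient_of_ends (fun p hp => ?_) hp
    rw [sign_orient_gridPoint]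
    exact hF.sign_gridOrient a b b p hp _ (F.left_mem_ends b) _ (F.right_mem_ends b)
      (hF.ends_lt_ends hab p hp _ (F.left_mem_ends b))
      ((hF.eq_or_lt b).resolve_left (hne' rfl))
  · exact hF.sign_orient_of_lt_of_lt hab hbc hp hq hr

theorem exists_isWord (hF : F.IsCoherent) {S : Finset Plane} (hS : S ⊆ F.cloud k) {n : ℕ}
    (hn : n ≤ S.card) :
    ∃ (p : Fin n → Plane) (w : Fin n → Fin m), (∀ i, p i ∈ S) ∧ (∀ i, p i ∈ F.points k (w i)) ∧
      StrictMono (fun i => p i 0) ∧ F.IsWord w := by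
  obtain ⟨p, hpS, hp⟩ := ((hF.distinctX_cloud k).mono hS).exists_strictMono hn
  choose w hw using fun i => mem_cloud.1 (hS (hpS i))
  exact ⟨p, w, hpS, hw, hp, fun i j hij => hF.step_of_lt (hw i) (hw j) (hp hij)⟩

theorem orientedLE_cloud (hF : F.IsCoherent) {s : SignType} {n : ℕ}
    (h : ∀ w : Fin (n + 1) → Fin m, F.IsWord w →
      ∃ i j l, i < j ∧ j < l ∧ F.orientation (w i) (w j) (w l) ≠ s) (k : ℕ) :
    OrientedLE s n (F.cloud k) := by
  intro S hS hs
  by_contra! hcard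
  obtain ⟨p, w, hpS, hpw, hp, hw⟩ := hF.exists_isWord hS hcard
  obtain ⟨i, j, l, hij, hjl, hne⟩ := h w hw
  rw [← hF.sign_orient (hpw i) (hpw j) (hpw l) (hp hij) (hp hjl)] at hne
  exact hne (hs _ (hpS i) _ (hpS j) _ (hpS l) (hp hij) (hp hjl))

theorem orientedLE_zero_cloud (hF : F.IsCoherent) (hk : 2 ≤ k)
    (h : ∀ a b c, F.Step a b → F.Step b c → F.orientation a b c = 0 → a = c) :
    OrientedLE 0 k (F.cloud k) := by
  intro S hS hs
  by_contra! hcard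
  obtain ⟨p, w, hpS, hpw, hp, -⟩ := hF.exists_isWord hS (n := 3) (by omega)
  have hends {a b c : Fin m} {x y z : Plane} (hx : x ∈ S) (hy : y ∈ S) (hz : z ∈ S)
      (hxa : x ∈ F.points k a) (hyb : y ∈ F.points k b) (hzc : z ∈ F.points k c)
      (hxy : x 0 < y 0) (hyz : y 0 < z 0) : a = c :=
    h a b c (hF.step_of_lt hxa hyb hxy) (hF.step_of_lt hyb hzc hyz) <|
      (hF.sign_orient hxa hyb hzc hxy hyz).symm.trans (hs x hx y hy z hz hxy hyz)
  have h01 : p 0 0 < p 1 0 := hp (by decide)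
  have h12 : p 1 0 < p 2 0 := hp (by decide)
  have hw02 : w 0 = w 2 := hends (hpS 0) (hpS 1) (hpS 2) (hpw 0) (hpw 1) (hpw 2) h01 h12
  have hw01 : w 1 = w 0 :=
    le_antisymm ((hF.step_of_lt (hpw 1) (hpw 2) h12).1.trans_eq hw02.symm)
      (hF.step_of_lt (hpw 0) (hpw 1) h01).1
  have hsub : S ⊆ F.points k (w 0) := fun q hq => by
    obtain ⟨d, hd⟩ := mem_cloud.1 (hS hq)
    obtain hlt | heq | hlt := lt_trichotomy (q 0) (p 1 0)
    · rwa [hw02, ← hends hq (hpS 1) (hpS 2) hd (hpw 1) (hpw 2) hlt h12]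
    · rw [hF.distinctX_cloud k (hS hq) (hS (hpS 1)) heq, ← hw01]
      exact hpw 1
    · rwa [hends (hpS 0) (hpS 1) hq (hpw 0) (hpw 1) hd h01 hlt]
  have := (Finset.card_le_card hsub).trans Finset.card_image_le
  rw [Finset.card_range] at this
  omega

theorem not_hasConvexPosition_cloud (hF : F.IsCoherent) {n : ℕ}
    (h : ∀ w : Fin n → Fin m, F.IsWord w → F.IsSandwiched w) (k : ℕ) :
    ¬ HasConvexPosition n (F.cloud k) := by
  rintro ⟨S, hS, hcard, hconv⟩
  obtain ⟨p, w, hpS, hpw, hp, hw⟩ := hF.exists_isWord hS hcard.ge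
  obtain ⟨q, ⟨u, huq, v, hqv, hbelow⟩, u', huq', v', hqv', habove⟩ := h w hw
  rw [← hF.sign_orient (hpw u) (hpw q) (hpw v) (hp huq) (hp hqv), sign_nonneg_iff] at hbelow
  rw [← hF.sign_orient (hpw u') (hpw q) (hpw v') (hp huq') (hp hqv'), sign_nonpos_iff] at habove
  exact hconv.not_aboveChord (hpS q) ⟨_, hpS u, _, hpS v, hp huq, hp hqv, hbelow⟩
    ⟨_, hpS u', _, hpS v', hp huq', hp hqv', habove⟩

end IsCoherent

/-- A single horizontal segment. -/
def line : SegmentSystem 1 where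
  left := ![(0, 0)]
  right := ![(1, 0)]

/-- A descending segment followed by an ascending one. -/
def valley : SegmentSystem 2 where
  left := ![(-2, 2), (1, 1)]
  right := ![(-1, 1), (2, 2)]

/-- An ascending segment followed by a descending one. -/
def roof : SegmentSystem 2 where
  left := ![(-2, -2), (1, -1)]
  right := ![(-1, -1), (2, -2)]

/-- Three segments and two points that contain no convex pentagon. -/
def pentagonFree : SegmentSystem 5 where
  left := ![(0, 0), (4, 5), (6, 4), (8, 1), (14, 5)]
  right := ![(3, 1), (4, 5), (7, 4), (12, 0), (14, 5)]

/-- The vertices of two nested triangles such that each side of the inner triangle, when extended,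
passes through a vertex of the outer one. -/
def nestedTriangles : SegmentSystem 6 where
  left := ![(-3, -1), (0, 0), (1, 3), (2, 6), (3, 1), (5, -1)]
  right := ![(-3, -1), (0, 0), (1, 3), (2, 6), (3, 1), (5, -1)]

theorem isCoherent_line : line.IsCoherent :=
  ⟨by decide, by decide, by decide +kernel⟩

theorem isCoherent_valley : valley.IsCoherent :=
  ⟨by decide, by decide, by decide +kernel⟩

theorem isCoherent_roof : roof.IsCoherent :=
  ⟨by decide, by decide, by decide +kernel⟩

theorem isCoherent_pentagonFree : pentagonFree.IsCoherent :=
  ⟨by decide, by decide, by decide +kernel⟩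

theorem isCoherent_nestedTriangles : nestedTriangles.IsCoherent :=
  ⟨by decide, by decide, by decide +kernel⟩

theorem card_line (hk : 0 < k) : (line.cloud k).card = k := by
  rw [isCoherent_line.card_cloud hk]
  simp [line]

theorem cupCapFree_line (hk : 2 ≤ k) : CupCapFree k 2 2 (line.cloud k) where
  distinctX := isCoherent_line.distinctX_cloud k
  collinear := isCoherent_line.orientedLE_zero_cloud hk (by decide +kernel)
  cap := isCoherent_line.orientedLE_cloud (by decide +kernel) k
  cup := isCoherent_line.orientedLE_cloud (by decide +kernel) k

theorem card_valley (hk : 0 < k) : (valley.cloud k).card = 2 * k := by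
  rw [isCoherent_valley.card_cloud hk]
  simp [valley, two_mul]

theorem cupCapFree_valley (hk : 2 ≤ k) : CupCapFree k 2 4 (valley.cloud k) where
  distinctX := isCoherent_valley.distinctX_cloud k
  collinear := isCoherent_valley.orientedLE_zero_cloud hk (by decide +kernel)
  cap := isCoherent_valley.orientedLE_cloud (by decide +kernel) k
  cup := isCoherent_valley.orientedLE_cloud (by decide +kernel) k

theorem card_roof (hk : 0 < k) : (roof.cloud k).card = 2 * k := by
  rw [isCoherent_roof.card_cloud hk]
  simp [roof, two_mul]

theorem cupCapFree_roof (hk : 2 ≤ k) : CupCapFree k 4 2 (roof.cloud k) where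
  distinctX := isCoherent_roof.distinctX_cloud k
  collinear := isCoherent_roof.orientedLE_zero_cloud hk (by decide +kernel)
  cap := isCoherent_roof.orientedLE_cloud (by decide +kernel) k
  cup := isCoherent_roof.orientedLE_cloud (by decide +kernel) k

theorem card_pentagonFree (hk : 0 < k) : (pentagonFree.cloud k).card = 3 * k + 2 := by
  rw [isCoherent_pentagonFree.card_cloud hk]
  calc _ = k + 1 + k + k + 1 := by simp [pentagonFree, Fin.sum_univ_five]
    _ = 3 * k + 2 := by ring

theorem card_nestedTriangles : (nestedTriangles.cloud 1).card = 6 := by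
  rw [isCoherent_nestedTriangles.card_cloud one_pos]
  simp

end SegmentSystem

namespace CupCapSize

variable {k : ℕ}

open SegmentSystem

theorem line (hk : 2 ≤ k) : CupCapSize k 2 2 k :=
  ⟨_, card_line (by omega), cupCapFree_line hk⟩

theorem valley (hk : 2 ≤ k) : CupCapSize k 2 4 (2 * k) :=
  ⟨_, card_valley (by omega), cupCapFree_valley hk⟩

theorem roof (hk : 2 ≤ k) : CupCapSize k 4 2 (2 * k) :=
  ⟨_, card_roof (by omega), cupCapFree_roof hk⟩

end CupCapSize

theorem cupCapRow_four {k : ℕ} (hk : 2 ≤ k) : CupCapRow k 4 (k + 2) := by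
  refine ⟨fun | 1, 3 | 3, 1 => 1 | 2, 2 => k | _, _ => 0, fun a b hab => ?_, ?_⟩
  · obtain rfl : b = 4 - a := by omega
    have ha : a ≤ 4 := by omega
    interval_cases a
    exacts [.zero, .one (by omega) (by omega) (by omega), .line hk,
      .one (by omega) (by omega) (by omega), .zero]
  · change 0 + (1 + (k + (1 + (0 + 0)))) = k + 2
    ring

theorem cupCapRow_six {k : ℕ} (hk : 2 ≤ k) : CupCapRow k 6 (6 * k + 4) := by
  have h13 : CupCapSize k 1 3 1 := .one (by omega) (by omega) (by omega)
  have h31 : CupCapSize k 3 1 1 := .one (by omega) (by omega) (by omega)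
  have h33 : CupCapSize k 3 3 (1 + k + (k + 1)) :=
    (h13.add hk (.line hk)).add hk (CupCapSize.add hk (.line hk) h31)
  refine ⟨fun | 1, 5 | 5, 1 => 1 | 2, 4 | 4, 2 => 2 * k | 3, 3 => 1 + k + (k + 1) | _, _ => 0,
    fun a b hab => ?_, ?_⟩
  · obtain rfl : b = 6 - a := by omega
    have ha : a ≤ 6 := by omega
    interval_cases a
    exacts [.zero, .one (by omega) (by omega) (by omega), .valley hk, h33, .roof hk,
      .one (by omega) (by omega) (by omega), .zero]
  · change 0 + (1 + (2 * k + (1 + k + (k + 1) + (2 * k + (1 + (0 + 0)))))) = 6 * k + 4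
    ring

theorem not_forces_three {k : ℕ} (hk : 2 ≤ k) : ¬ Forces (k + 1) 3 k := by
  have h := not_forces (SegmentSystem.cupCapFree_line hk).collinear
    (SegmentSystem.isCoherent_line.not_hasConvexPosition_cloud (n := 3) (by decide +kernel) k)
  rwa [SegmentSystem.card_line (by omega)] at h

theorem not_forces_four_four : ¬ Forces 4 4 6 := by
  have h := SegmentSystem.isCoherent_nestedTriangles
  rw [← SegmentSystem.card_nestedTriangles]
  exact not_forces (h.orientedLE_cloud (by decide +kernel) 1)
    (h.not_hasConvexPosition_cloud (by decide +kernel) 1)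

theorem not_forces_five {k : ℕ} (hk : 2 ≤ k) : ¬ Forces (k + 1) 5 (3 * k + 2) := by
  have h := SegmentSystem.isCoherent_pentagonFree
  rw [← SegmentSystem.card_pentagonFree (by omega)]
  exact not_forces (h.orientedLE_zero_cloud hk (by decide +kernel))
    (h.not_hasConvexPosition_cloud (by decide +kernel) k)

theorem theorem2 (ℓ n : ℕ) (hℓ : 3 ≤ ℓ) (hn : 3 ≤ n) (h4 : n = 4 → ℓ ≤ 4) :
    ENNReal.ofReal ((3 * (ℓ : ℝ) - 1) * (2 : ℝ) ^ ((n : ℤ) - 5) + 1) ≤ (ES ℓ n : ℝ≥0∞) := by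
  obtain ⟨k, rfl⟩ : ∃ k, ℓ = k + 1 := ⟨ℓ - 1, by omega⟩
  have hk : 2 ≤ k := by omega
  have hkℝ : (2 : ℝ) ≤ k := Nat.ofNat_le_cast.2 hk
  obtain rfl | rfl | rfl | h6 : n = 3 ∨ n = 4 ∨ n = 5 ∨ 6 ≤ n := by omega
  · refine ofReal_add_one_le_ES (not_forces_three hk) ?_
    simp only [Nat.cast_add, Nat.cast_one, Nat.cast_ofNat, Int.reduceSub, zpow_neg, zpow_ofNat]
    linarith
  · obtain rfl | rfl : k = 2 ∨ k = 3 := by omega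
    · exact ofReal_add_one_le_ES ((cupCapRow_four le_rfl).not_forces le_rfl four_pos) (by norm_num)
    · exact ofReal_add_one_le_ES not_forces_four_four (by norm_num)
  · refine ofReal_add_one_le_ES (not_forces_five hk) ?_
    push_cast
    linarith
  · obtain ⟨t, rfl⟩ := Nat.exists_eq_add_of_le h6
    refine ofReal_add_one_le_ES (((cupCapRow_six hk).iterate hk t).not_forces hk (by omega)) ?_
    have hexp : ((6 + t : ℕ) : ℤ) - 5 = (t + 1 : ℕ) := by omega
    rw [hexp, zpow_natCast, pow_succ]
    push_cast
    linarith
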